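/- Let $G=(V,\mathcal A)$ be a finite hypergraph, $\mathcal A\subseteq 2^V$, and let $f:\{0,1\}^V\to\mathbb R_{\ge 0}$ be given with a factorization over $G$, $$f(x)=\prod_{i\in V}\phi_i(x_i)\prod_{\alpha\in\mathcal A}\psi_\alpha(x_\alpha),\qquad \phi_i:\{0,1\}\to\mathbb R_{\ge0},\quad \psi_\alpha:\{0,1\}^\alpha\to\mathbb R_{\ge0},$$ where $x_\alpha=(x_i)_{i\in\alpha}$. Assume that every factor potential is log-supermodular: $\psi_\alpha(x)\psi_\alpha(y)\le\psi_\alpha(x\wedge y)\,\psi_\alpha(x\vee y)$ for all $\alpha\in\mathcal A$ and $x,y\in\{0,1\}^\alpha$, with coordinatewise minimum $\wedge$ and maximum $\vee$. The sets $\alpha$ may have any size. Let $Z(G)=\sum_{x\in\{0,1\}^V}f(x)$. Let $\mathcal T$ be the local marginal polytope: the set of all families $\tau=((\tau_i)_{i\in V},(\tau_\alpha)_{\alpha\in\mathcal A})$ of probability vectors $\tau_i$ on $\{0,1\}$ and $\tau_\alpha$ on $\{0,1\}^\alpha$ such that $\sum_{x_\alpha:\,x_i=b}\tau_\alpha(x_\alpha)=\tau_i(b)$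 for all $\alpha\in\mathcal A$, $i\in\alpha$, $b\in\{0,1\}$. For $\tau\in\mathcal T$ define $Z_{\mathrm B}(G,\tau)\in[0,\infty)$ by $$\log Z_{\mathrm B}(G,\tau)=\sum_{i\in V}\sum_{x_i}\tau_i(x_i)\log\phi_i(x_i)+\sum_{\alpha\in\mathcal A}\sum_{x_\alpha}\tau_\alpha(x_\alpha)\log\psi_\alpha(x_\alpha)-\sum_{i\in V}\sum_{x_i}\tau_i(x_i)\log\tau_i(x_i)-\sum_{\alpha\in\mathcal A}\sum_{x_\alpha}\tau_\alpha(x_\alpha)\log\frac{\tau_\alpha(x_\alpha)}{\prod_{i\in\alpha}\tau_i(x_i)},$$ with $\log 0=-\infty$ and the convention that every term with coefficient $\tau_i(x_i)=0$ or $\tau_\alpha(x_\alpha)=0$ is $0$. Then: 1. The Bethe partition function $Z_{\mathrm B}(G)=\sup_{\tau\in\mathcal T}Z_{\mathrm B}(G,\tau)$ is attained on $\mathcal T$ (it is a maximum), and $$Z_{\mathrm B}(G)\le Z(G).$$ 2. The same bound holds at every fixed point of belief propagation. That is, suppose that for all $\alpha\in\mathcal A$, $i\in\alpha$ there are nonnegative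 messages $m_{i\to\alpha},m_{\alpha\to i}:\{0,1\}\to\mathbb R$, each the normalization to total mass $1$ of the right-hand side (assumed to have positive total mass) in $$m_{i\to\alpha}(b)\propto\phi_i(b)\prod_{\beta\ni i,\ \beta\ne\alpha}m_{\beta\to i}(b),\qquad m_{\alpha\to i}(b)\propto\sum_{x\in\{0,1\}^\alpha:\,x_i=b}\psi_\alpha(x)\prod_{j\in\alpha\setminus\{i\}}m_{j\to\alpha}(x_j),$$ and suppose that the beliefs $\tau$, likewise the normalizations in $$\tau_i(b)\propto\phi_i(b)\prod_{\alpha\ni i}m_{\alpha\to i}(b),\qquad \tau_\alpha(x)\propto\psi_\alpha(x)\prod_{j\in\alpha}m_{j\to\alpha}(x_j),$$ exist. Then $\tau\in\mathcal T$ and $Z_{\mathrm B}(G,\tau)\le Z(G)$. In particular, the bounds hold for attractive pairwise binary models, that is, log-supermodular factorizations with $|\alpha|\le 2$ for all $\alpha\in\mathcal A$. -/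

import Mathlib

open scoped NNReal ENNReal

namespace BetheLSM

noncomputable section

/-- A nonnegative function `g` on `{0,1}^ι` is log-supermodular if
`g x * g y ≤ g (x ∧ y) * g (x ∨ y)` for all `x`, `y`.  Here `{0,1}` is `Bool` with
`false < true`, and meets and joins are taken coordinatewise. -/
def LogSupermodular {ι : Type*} (g : (ι → Bool) → ℝ≥0) : Prop :=
  ∀ x y : ι → Bool, g x * g y ≤ g (x ⊓ y) * g (x ⊔ y)

/-- A factorization of `f : {0,1}^V → ℝ≥0` over the hypergraph `(V, A)`: node potentials `φ i`
and factor potentials `ψ α`, with `f x = ∏ i, φ i (x i) * ∏ α ∈ A, ψ α (x restricted to α)`. -/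
structure Factorization {V : Type*} [Fintype V] (A : Finset (Finset V))
    (f : (V → Bool) → ℝ≥0) where
  /-- node potentials -/
  φ : V → Bool → ℝ≥0
  /-- factor potentials -/
  ψ : (α : A) → (α.1 → Bool) → ℝ≥0
  /-- the product of all the potentials is `f` -/
  eq_prod : ∀ x : V → Bool, f x = (∏ i, φ i (x i)) * ∏ α : A, ψ α (fun i => x i)

/-- The factorization is log-supermodular if every factor potential is. -/
def Factorization.IsLogSupermodular {V : Type*} [Fintype V] {A : Finset (Finset V)}
    {f : (V → Bool) → ℝ≥0} (F : Factorization A f) : Prop :=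
  ∀ α : A, LogSupermodular (F.ψ α)

/-- The partition function `Z(G) = ∑ x, f x`. -/
def partitionFunction {V : Type*} [Fintype V] [DecidableEq V] (f : (V → Bool) → ℝ≥0) : ℝ≥0 :=
  ∑ x, f x

/-- The ambient space of `τ = ((τ_i)_{i ∈ V}, (τ_α)_{α ∈ A})`. -/
abbrev Beliefs {V : Type*} (A : Finset (Finset V)) : Type _ :=
  (V → Bool → ℝ) × ((α : A) → (α.1 → Bool) → ℝ)

/-- The local marginal polytope.  The normalization of `τ_α` follows from the other conditions
when `α` is nonempty; it is only needed for an empty hyperedge. -/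
def localPolytope {V : Type*} [DecidableEq V] (A : Finset (Finset V)) : Set (Beliefs A) :=
  {τ | (∀ i b, 0 ≤ τ.1 i b) ∧
       (∀ α x, 0 ≤ τ.2 α x) ∧
       (∀ i, ∑ b, τ.1 i b = 1) ∧
       (∀ α, ∑ x, τ.2 α x = 1) ∧
       (∀ (α : A) (i : α.1) (b : Bool), ∑ x with x i = b, τ.2 α x = τ.1 i b)}

/-- The Bethe entropy
`- ∑ i, ∑ b, τ_i(b) log τ_i(b) - ∑ α, ∑ x, τ_α(x) log (τ_α(x) / ∏ i ∈ α, τ_i(x_i))`.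
On the local marginal polytope `τ_α(x) > 0` forces `∏ i ∈ α, τ_i(x_i) > 0`, so that the real
logarithm only brings in the usual convention `0 log 0 = 0`. -/
def betheEntropy {V : Type*} [Fintype V] [DecidableEq V] {A : Finset (Finset V)}
    (τ : Beliefs A) : ℝ :=
  - (∑ i, ∑ b, τ.1 i b * Real.log (τ.1 i b))
    - ∑ α : A, ∑ x, τ.2 α x * Real.log (τ.2 α x / ∏ i : α.1, τ.1 i (x i))

/-- `log Z_B(G, τ)` as an extended real.  Potentials may vanish: `log 0 = -∞`, and
`0 * (-∞) = 0` in `EReal`. -/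
def logBethe {V : Type*} [Fintype V] [DecidableEq V] {A : Finset (Finset V)}
    {f : (V → Bool) → ℝ≥0} (F : Factorization A f) (τ : Beliefs A) : EReal :=
  (∑ i, ∑ b, (τ.1 i b : EReal) * ENNReal.log (F.φ i b : ℝ≥0∞))
    + (∑ α : A, ∑ x, (τ.2 α x : EReal) * ENNReal.log (F.ψ α x : ℝ≥0∞))
    + (betheEntropy τ : EReal)

/-- The Bethe approximation `Z_B(G, τ)`. -/
def betheValue {V : Type*} [Fintype V] [DecidableEq V] {A : Finset (Finset V)}
    {f : (V → Bool) → ℝ≥0} (F : Factorization A f) (τ : Beliefs A) : ℝ≥0∞ :=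
  EReal.exp (logBethe F τ)

/-- The Bethe partition function `Z_B(G)`: the supremum of `Z_B(G, τ)` over the local marginal
polytope (the theorem also asserts that it is attained). -/
def bethePartitionFunction {V : Type*} [Fintype V] [DecidableEq V] {A : Finset (Finset V)}
    {f : (V → Bool) → ℝ≥0} (F : Factorization A f) : ℝ≥0∞ :=
  ⨆ τ ∈ localPolytope A, betheValue F τ

/-- `p` is the probability vector proportional to `q`, where `q` has positive total mass. -/
def IsNormalizationOf {X : Type*} [Fintype X] (p q : X → ℝ) : Prop :=
  0 < ∑ y, q y ∧ ∀ x, p x = q x / ∑ y, q y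

/-- The (normalized) sum-product messages `m α i` from the variable `i` to the factor `α` and
`m' α i` from the factor `α` to the variable `i` form a fixed point of belief propagation:
* `m α i b ∝ φ_i(b) * ∏_{β ∋ i, β ≠ α} m' β i b`,
* `m' α i b ∝ ∑_{x ∈ {0,1}^α, x_i = b} ψ_α(x) * ∏_{j ∈ α, j ≠ i} m α j x_j`.
Entries with `i ∉ α` are not used. -/
structure IsBPFixedPoint {V : Type*} [Fintype V] [DecidableEq V] {A : Finset (Finset V)}
    {f : (V → Bool) → ℝ≥0} (F : Factorization A f) (m m' : A → V → Bool → ℝ) : Prop where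
  nonneg : ∀ (α : A) (i : α.1) (b : Bool), 0 ≤ m α i b
  nonneg' : ∀ (α : A) (i : α.1) (b : Bool), 0 ≤ m' α i b
  var_to_factor : ∀ (α : A) (i : α.1), IsNormalizationOf (m α i)
    (fun b => (F.φ i b : ℝ) * ∏ β : A with i.1 ∈ β.1 ∧ β ≠ α, m' β i b)
  factor_to_var : ∀ (α : A) (i : α.1), IsNormalizationOf (m' α i)
    (fun b => ∑ x : α.1 → Bool with x i = b,
      (F.ψ α x : ℝ) * ∏ j : α.1 with j ≠ i, m α j (x j))

/-- `τ` is the family of beliefs given by the messages `m`, `m'`: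
`τ_i(b) ∝ φ_i(b) * ∏_{α ∋ i} m' α i b` and `τ_α(x) ∝ ψ_α(x) * ∏_{j ∈ α} m α j x_j`. -/
structure IsBPBelief {V : Type*} [Fintype V] [DecidableEq V] {A : Finset (Finset V)}
    {f : (V → Bool) → ℝ≥0} (F : Factorization A f) (m m' : A → V → Bool → ℝ)
    (τ : Beliefs A) : Prop where
  node : ∀ i : V, IsNormalizationOf (τ.1 i)
    (fun b => (F.φ i b : ℝ) * ∏ α : A with i ∈ α.1, m' α i b)
  factor : ∀ α : A, IsNormalizationOf (τ.2 α)
    (fun x => (F.ψ α x : ℝ) * ∏ j : α.1, m α j (x j))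

end

end BetheLSM

/-! Make all variables and all factors independent, each with its marginal under τ. The entropy of
this product law `productBelief τ` exceeds the Bethe entropy by exactly the sum of H(τ_i) over all
incidences i ∈ α (`betheEntropy_eq`, `entropy_productBelief`), and its mean energy is the Bethe
energy. So it suffices to force the two copies of x_i at each incidence to agree, losing at most
H(τ_i) of entropy each time and never lowering the mean energy. The result is in effect a law on
{0,1}^V, and the Gibbs variational principle (`entropy_add_sum_energy_le`) bounds its entropy plus
energy by log Z(G).

One gluing (`exists_supermodularLE_eq`) splits the law by the values of the two copies. Since the
copies have equal laws, the parts 01 and 10 have equal mass; couple them and replace each coupled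
pair by its meet and join, which lie in 00 and 11. Supermodularity keeps the mean energy from
dropping, and coordinates keep their laws, so the next incidence can be glued.

The entropy loss is controlled by an entropic four functions theorem (`EntropicFourFunctions`): for
a suitable coupling, meet and join together have at least the entropy of the original pair. It holds
on a two-element chain and passes to products by the chain rule (`EntropicFourFunctions.prod`),
hence holds on every finite cube.

At a fixed point of belief propagation the update rules put the beliefs in the polytope, so the same
bound applies. The maximum exists because log Z_B is continuous on the compact set of beliefs that
vanish where the potentials do, while Z_B is 0 on the rest of the polytope. -/

namespace BetheLSM

open Finset Real

/-! ### Entropy of finite weights -/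

/-- The entropy of a (not necessarily normalized) nonnegative weight on a finite type. -/
noncomputable def entropy {X : Type*} [Fintype X] (μ : X → ℝ) : ℝ := ∑ x, negMulLog (μ x)

/-- The entropy of a weight minus the entropy of its total mass; it is homogeneous of degree one
and superadditive. -/
noncomputable def innerEntropy {X : Type*} [Fintype X] (μ : X → ℝ) : ℝ :=
  entropy μ - negMulLog (∑ x, μ x)

open Classical in
/-- The pushforward of a weight along a map of finite types. -/
noncomputable def pushforward {X Y : Type*} [Fintype X] (f : X → Y) (μ : X → ℝ) (y : Y) : ℝ :=
  ∑ x, if f x = y then μ x else 0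

section Pushforward

variable {X Y : Type*} [Fintype X]

theorem pushforward_nonneg {f : X → Y} {μ : X → ℝ} (hμ : ∀ x, 0 ≤ μ x) (y : Y) :
    0 ≤ pushforward f μ y :=
  sum_nonneg fun x _ => by split_ifs <;> simp [hμ x]

theorem sum_pushforward_mul [Fintype Y] (f : X → Y) (μ : X → ℝ) (h : Y → ℝ) :
    ∑ y, pushforward f μ y * h y = ∑ x, μ x * h (f x) := by
  classical
  simp only [pushforward, sum_mul]
  rw [sum_comm]
  refine sum_congr rfl fun x _ => ?_
  simp [ite_mul]

theorem sum_pushforward [Fintype Y] (f : X → Y) (μ : X → ℝ) :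
    ∑ y, pushforward f μ y = ∑ x, μ x := by
  simpa using sum_pushforward_mul f μ fun _ => 1

theorem exists_of_pushforward_ne_zero {f : X → Y} {μ : X → ℝ} {y : Y}
    (h : pushforward f μ y ≠ 0) : ∃ x, f x = y ∧ μ x ≠ 0 := by
  obtain ⟨x, -, hx⟩ := exists_ne_zero_of_sum_ne_zero h
  by_cases hxy : f x = y
  · exact ⟨x, hxy, by simpa [hxy] using hx⟩
  · simp [hxy] at hx

theorem eq_zero_of_pushforward_eq_zero {f : X → Y} {μ : X → ℝ} (hμ : ∀ x, 0 ≤ μ x) {y : Y}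
    (h : pushforward f μ y = 0) {x : X} (hx : f x = y) : μ x = 0 := by
  classical
  have := (sum_eq_zero_iff_of_nonneg fun x _ => by split_ifs <;> simp [hμ x]).1 h x (mem_univ x)
  simpa [hx] using this

theorem pushforward_fst {S : Type*} [Fintype S] (c : S × X → ℝ) (s : S) :
    pushforward Prod.fst c s = ∑ x, c (s, x) := by
  classical
  simp only [pushforward, Fintype.sum_prod_type]
  rw [sum_eq_single s (fun t _ ht => by simp [ht]) (by simp)]
  simp

theorem pushforward_snd {S : Type*} [Fintype S] (c : S × X → ℝ) (x : X) :
    pushforward Prod.snd c x = ∑ s, c (s, x) := by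
  classical
  simp only [pushforward, Fintype.sum_prod_type]
  exact sum_congr rfl fun s _ => by simp

end Pushforward

/-- This is log t ≤ t - 1 at t = v / u. Summed over two weights of equal mass it is Gibbs'
inequality. -/
theorem negMulLog_le_sub_mul_log {u v : ℝ} (hu : 0 ≤ u) (hv : 0 ≤ v) (h : v = 0 → u = 0) :
    negMulLog u ≤ v - u - u * log v := by
  rcases hu.eq_or_lt with rfl | hu
  · simpa using hv
  have hv : 0 < v := hv.lt_of_ne fun h0 => hu.ne' (h h0.symm)
  have h1 := log_le_sub_one_of_pos (div_pos hv hu)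
  rw [log_div hv.ne' hu.ne'] at h1
  have h2 := mul_le_mul_of_nonneg_left h1 hu.le
  have h3 : u * (v / u - 1) = v - u := by field_simp
  rw [negMulLog]
  linarith

section InnerEntropy

variable {X : Type*} [Fintype X]

theorem innerEntropy_eq_sum (μ : X → ℝ) :
    innerEntropy μ = ∑ x, (negMulLog (μ x) + μ x * log (∑ y, μ y)) := by
  rw [innerEntropy, entropy, sum_add_distrib, ← sum_mul, negMulLog]
  ring

theorem innerEntropy_zero : innerEntropy (fun _ : X => 0) = 0 := by
  simp [innerEntropy, entropy]

theorem innerEntropy_const_mul (t : ℝ) (μ : X → ℝ) :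
    innerEntropy (fun x => t * μ x) = t * innerEntropy μ := by
  rw [innerEntropy, innerEntropy, entropy, entropy, ← mul_sum, negMulLog_mul]
  simp_rw [negMulLog_mul]
  rw [sum_add_distrib, ← sum_mul, ← mul_sum]
  ring

/-- The log-sum inequality: compare each u with the share of its M at the pooled ratio (u₁ + u₂) /
(M₁ + M₂); the two shares add up to u₁ + u₂. -/
theorem negMulLog_add_mul_log_add_le {u₁ u₂ M₁ M₂ : ℝ} (h₁ : 0 ≤ u₁) (h₂ : 0 ≤ u₂)
    (hM₁ : u₁ ≤ M₁) (hM₂ : u₂ ≤ M₂) :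
    (negMulLog u₁ + u₁ * log M₁) + (negMulLog u₂ + u₂ * log M₂) ≤
      negMulLog (u₁ + u₂) + (u₁ + u₂) * log (M₁ + M₂) := by
  have key : ∀ u M, 0 ≤ u → u ≤ M → u ≤ u₁ + u₂ → M ≤ M₁ + M₂ →
      negMulLog u ≤ M * ((u₁ + u₂) / (M₁ + M₂)) - u
        - u * (log M + log (u₁ + u₂) - log (M₁ + M₂)) := by
    intro u M hu huM huu hMM
    rcases hu.eq_or_lt with rfl | hu
    · simp only [negMulLog_zero, zero_mul, sub_zero]
      exact mul_nonneg huM (div_nonneg huu (huM.trans hMM))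
    have hM : 0 < M := hu.trans_le huM
    have hu' : 0 < u₁ + u₂ := hu.trans_le huu
    have hM' : 0 < M₁ + M₂ := hM.trans_le hMM
    have hpos : 0 < M * ((u₁ + u₂) / (M₁ + M₂)) := by positivity
    have := negMulLog_le_sub_mul_log hu.le hpos.le fun h => absurd h hpos.ne'
    rwa [log_mul hM.ne' (by positivity), log_div hu'.ne' hM'.ne', ← add_sub_assoc] at this
  have k₁ := key u₁ M₁ h₁ hM₁ (by linarith) (by linarith)
  have k₂ := key u₂ M₂ h₂ hM₂ (by linarith) (by linarith)
  have k₃ : M₁ * ((u₁ + u₂) / (M₁ + M₂)) + M₂ * ((u₁ + u₂) / (M₁ + M₂)) = u₁ + u₂ := by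
    rw [← add_mul]
    refine mul_div_cancel_of_imp' fun h => ?_
    linarith
  rw [negMulLog.eq_def (u₁ + u₂)]
  linarith

theorem innerEntropy_add_le {μ ν : X → ℝ} (hμ : ∀ x, 0 ≤ μ x) (hν : ∀ x, 0 ≤ ν x) :
    innerEntropy μ + innerEntropy ν ≤ innerEntropy (fun x => μ x + ν x) := by
  rw [innerEntropy_eq_sum, innerEntropy_eq_sum, innerEntropy_eq_sum, ← sum_add_distrib]
  refine sum_le_sum fun x _ => ?_
  rw [sum_add_distrib]
  exact negMulLog_add_mul_log_add_le (hμ x) (hν x)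
    (single_le_sum (fun y _ => hμ y) (mem_univ x)) (single_le_sum (fun y _ => hν y) (mem_univ x))

theorem sum_innerEntropy_le {K : Type*} (s : Finset K) {μ : K → X → ℝ} (hμ : ∀ k x, 0 ≤ μ k x) :
    ∑ k ∈ s, innerEntropy (μ k) ≤ innerEntropy (fun x => ∑ k ∈ s, μ k x) := by
  classical
  induction s using Finset.induction_on with
  | empty => simp [innerEntropy_zero]
  | insert a s ha ih =>
    simp only [sum_insert ha]
    exact (add_le_add_right ih _).trans
      (innerEntropy_add_le (hμ a) fun x => sum_nonneg fun k _ => hμ k x)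

/-- The chain rule for the entropy of a weight on a product. -/
theorem entropy_prod_eq {S : Type*} [Fintype S] (μ : S × X → ℝ) :
    entropy μ = entropy (fun s => ∑ x, μ (s, x)) + ∑ s, innerEntropy (fun x => μ (s, x)) := by
  simp only [entropy, innerEntropy, ← sum_add_distrib, Fintype.sum_prod_type]
  simp

/-- Conditioning reduces entropy. -/
theorem entropy_pushforward_add_sum_innerEntropy_le {K S : Type*} [Fintype K] [Fintype S]
    (f : K → S) {c : K → X → ℝ} (hc : ∀ k x, 0 ≤ c k x) :
    entropy (pushforward f fun k => ∑ x, c k x) + ∑ k, innerEntropy (c k) ≤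
      entropy (fun p : S × X => pushforward f (fun k => c k p.2) p.1) := by
  classical
  rw [entropy_prod_eq]
  have h1 : (fun s => ∑ x, pushforward f (fun k => c k x) s)
      = pushforward f fun k => ∑ x, c k x := by
    funext s
    simp only [pushforward]
    rw [sum_comm]
    refine sum_congr rfl fun k _ => ?_
    split_ifs <;> simp
  simp only [h1]
  gcongr
  rw [← sum_fiberwise univ f]
  refine sum_le_sum fun s _ => ?_
  refine (sum_innerEntropy_le _ hc).trans_eq ?_
  simp [pushforward, sum_filter]

end InnerEntropy

/-! ### The entropic four functions theorem -/

/-- The entropic four functions property of a finite lattice: any two weights of the same mass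
have a coupling for which the laws of the meet and the join have at least the total entropy of
the two weights. -/
def EntropicFourFunctions (L : Type*) [Lattice L] [Fintype L] : Prop :=
  ∀ μ ν : L → ℝ, (∀ x, 0 ≤ μ x) → (∀ x, 0 ≤ ν x) → ∑ x, μ x = ∑ x, ν x →
    ∃ c : L × L → ℝ, (∀ p, 0 ≤ c p) ∧ pushforward Prod.fst c = μ ∧ pushforward Prod.snd c = ν ∧
      entropy μ + entropy ν ≤
        entropy (pushforward (fun p => p.1 ⊓ p.2) c) + entropy (pushforward (fun p => p.1 ⊔ p.2) c)

namespace EntropicFourFunctions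

/-- Under the monotone coupling the laws of meet and join are μ and ν in some order, so equality
holds. -/
theorem bool : EntropicFourFunctions Bool := by
  have key : ∀ μ ν : Bool → ℝ, (∀ x, 0 ≤ μ x) → (∀ x, 0 ≤ ν x) → ∑ x, μ x = ∑ x, ν x →
      μ true ≤ ν true → ∃ c : Bool × Bool → ℝ, (∀ p, 0 ≤ c p) ∧ pushforward Prod.fst c = μ ∧
        pushforward Prod.snd c = ν ∧ pushforward (fun p => p.1 ⊓ p.2) c = μ ∧
        pushforward (fun p => p.1 ⊔ p.2) c = ν := by
    intro μ ν hμ hν h hle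
    simp only [Fintype.sum_bool] at h
    refine ⟨fun p => match p with
      | (false, false) => ν false
      | (false, true) => ν true - μ true
      | (true, false) => 0
      | (true, true) => μ true, ?_, ?_, ?_, ?_, ?_⟩
    · rintro ⟨_ | _, _ | _⟩ <;> simp [hμ, hν, hle]
    all_goals
      funext b
      cases b <;> simp [pushforward, Fintype.sum_prod_type] <;> linarith
  intro μ ν hμ hν h
  rcases le_total (μ true) (ν true) with hle | hle
  · obtain ⟨c, h0, h1, h2, h3, h4⟩ := key μ ν hμ hν h hle
    exact ⟨c, h0, h1, h2, by rw [h3, h4]⟩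
  · obtain ⟨c, h0, h1, h2, h3, h4⟩ := key ν μ hν hμ h.symm hle
    have hs : ∀ f : Bool × Bool → Bool,
        pushforward f (fun p => c p.swap) = pushforward (fun p => f p.swap) c := by
      intro f
      funext b
      simp only [pushforward]
      exact Fintype.sum_equiv (Equiv.prodComm _ _) _ _ fun p => by simp
    refine ⟨fun p => c p.swap, fun p => h0 _, ?_, ?_, ?_⟩
    · rw [hs]; exact h2
    · rw [hs]; exact h1
    · rw [hs, hs]
      simp only [Prod.fst_swap, Prod.snd_swap, inf_comm, sup_comm] at h3 h4 ⊢
      rw [h3, h4, add_comm]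

/-- Couple the first coordinates, then couple the conditional laws of the second coordinates given
each pair. The chain rule adds the two gains; the meet and join reveal less than the whole pair, and
conditioning on less only raises entropy. -/
theorem prod {L₁ L₂ : Type*} [Lattice L₁] [Fintype L₁] [Lattice L₂] [Fintype L₂]
    (H₁ : EntropicFourFunctions L₁) (H₂ : EntropicFourFunctions L₂) :
    EntropicFourFunctions (L₁ × L₂) := by
  classical
  intro μ ν hμ hν h
  set μ₁ : L₁ → ℝ := fun a => ∑ l, μ (a, l) with hμ₁
  set ν₁ : L₁ → ℝ := fun a => ∑ l, ν (a, l) with hν₁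
  have hμ₁0 : ∀ a, 0 ≤ μ₁ a := fun a => sum_nonneg fun l _ => hμ _
  have hν₁0 : ∀ a, 0 ≤ ν₁ a := fun a => sum_nonneg fun l _ => hν _
  obtain ⟨w, hw, hwμ, hwν, hwH⟩ := H₁ μ₁ ν₁ hμ₁0 hν₁0 (by
    simpa only [Fintype.sum_prod_type] using h)
  have hwμ' : ∀ a, ∑ b, w (a, b) = μ₁ a := fun a => by
    rw [← congrFun hwμ a, pushforward_fst]
  have hwν' : ∀ b, ∑ a, w (a, b) = ν₁ b := fun b => by
    rw [← congrFun hwν b, pushforward_snd]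
  have hwμ0 : ∀ p, μ₁ p.1 = 0 → w p = 0 := fun p hp =>
    eq_zero_of_pushforward_eq_zero hw (by rw [hwμ, hp]) rfl
  have hwν0 : ∀ p, ν₁ p.2 = 0 → w p = 0 := fun p hp =>
    eq_zero_of_pushforward_eq_zero hw (by rw [hwν, hp]) rfl
  -- The conditional law of the second coordinate, rescaled to mass `w p`. Where `μ₁ p.1 = 0`, also
  -- `w p = 0`, so division by zero is harmless.
  set M : L₁ × L₁ → L₂ → ℝ := fun p l => w p / μ₁ p.1 * μ (p.1, l) with hM
  set N : L₁ × L₁ → L₂ → ℝ := fun p l => w p / ν₁ p.2 * ν (p.2, l) with hN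
  have hM0 : ∀ p l, 0 ≤ M p l := fun p l => mul_nonneg (div_nonneg (hw _) (hμ₁0 _)) (hμ _)
  have hN0 : ∀ p l, 0 ≤ N p l := fun p l => mul_nonneg (div_nonneg (hw _) (hν₁0 _)) (hν _)
  have hMs : ∀ p, ∑ l, M p l = w p := fun p => by
    rw [hM, ← mul_sum]
    exact div_mul_cancel_of_imp (hwμ0 p)
  have hNs : ∀ p, ∑ l, N p l = w p := fun p => by
    rw [hN, ← mul_sum]
    exact div_mul_cancel_of_imp (hwν0 p)
  choose c hc hcM hcN hcH using fun p => H₂ (M p) (N p) (hM0 p) (hN0 p) ((hMs p).trans (hNs p).symm)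
  have hcs : ∀ p, ∑ q, c p q = w p := fun p => by
    rw [← hMs p, ← hcM p, sum_pushforward]
  set C : (L₁ × L₂) × (L₁ × L₂) → ℝ := fun q => c (q.1.1, q.2.1) (q.1.2, q.2.2) with hC
  have hpush : ∀ (f : L₁ × L₁ → L₁) (g : L₂ × L₂ → L₂),
      pushforward (fun q : (L₁ × L₂) × (L₁ × L₂) =>
        (f (q.1.1, q.2.1), g (q.1.2, q.2.2))) C =
      fun r : L₁ × L₂ => pushforward f (fun p => pushforward g (c p) r.2) r.1 := by
    intro f g
    funext r
    simp only [pushforward]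
    rw [← Equiv.sum_comp (Equiv.prodProdProdComm L₁ L₁ L₂ L₂), Fintype.sum_prod_type]
    refine sum_congr rfl fun p _ => ?_
    by_cases hp : f p = r.1
    · simp [hp, Prod.ext_iff, hC]
    · simp [hp, Prod.ext_iff]
  have hμz : ∀ a l, μ₁ a = 0 → μ (a, l) = 0 := fun a l ha =>
    (sum_eq_zero_iff_of_nonneg fun l _ => hμ (a, l)).1 ha l (mem_univ l)
  have hνz : ∀ a l, ν₁ a = 0 → ν (a, l) = 0 := fun a l ha =>
    (sum_eq_zero_iff_of_nonneg fun l _ => hν (a, l)).1 ha l (mem_univ l)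
  -- By homogeneity, and because the weights `w (a, b) / μ₁ a` sum to 1 over `b` when `μ₁ a` is
  -- nonzero.
  have hHμ : ∑ p, innerEntropy (M p) = ∑ a, innerEntropy (fun l => μ (a, l)) := by
    rw [Fintype.sum_prod_type]
    refine sum_congr rfl fun a _ => ?_
    simp only [hM, innerEntropy_const_mul]
    rw [← sum_mul, ← sum_div, hwμ']
    by_cases ha : μ₁ a = 0
    · simp [hμz a _ ha, innerEntropy_zero]
    · rw [div_self ha, one_mul]
  have hHν : ∑ p, innerEntropy (N p) = ∑ a, innerEntropy (fun l => ν (a, l)) := by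
    rw [Fintype.sum_prod_type_right]
    refine sum_congr rfl fun a _ => ?_
    simp only [hN, innerEntropy_const_mul]
    rw [← sum_mul, ← sum_div, hwν']
    by_cases ha : ν₁ a = 0
    · simp [hνz a _ ha, innerEntropy_zero]
    · rw [div_self ha, one_mul]
  refine ⟨C, fun q => hc _ _, ?_, ?_, ?_⟩
  · refine (hpush Prod.fst Prod.fst).trans ?_
    funext r
    simp only [hcM]
    rw [pushforward_fst]
    simp only [hM]
    rw [← sum_mul, ← sum_div, hwμ']
    by_cases ha : μ₁ r.1 = 0
    · rw [hμz r.1 r.2 ha, mul_zero]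
    · rw [div_self ha, one_mul]
  · refine (hpush Prod.snd Prod.snd).trans ?_
    funext r
    simp only [hcN]
    rw [pushforward_snd]
    simp only [hN]
    rw [← sum_mul, ← sum_div, hwν']
    by_cases ha : ν₁ r.1 = 0
    · rw [hνz r.1 r.2 ha, mul_zero]
    · rw [div_self ha, one_mul]
  · have hinf := entropy_pushforward_add_sum_innerEntropy_le (fun p : L₁ × L₁ => p.1 ⊓ p.2)
      (c := fun p => pushforward (fun q => q.1 ⊓ q.2) (c p))
      (fun p => pushforward_nonneg (hc p))
    have hsup := entropy_pushforward_add_sum_innerEntropy_le (fun p : L₁ × L₁ => p.1 ⊔ p.2)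
      (c := fun p => pushforward (fun q => q.1 ⊔ q.2) (c p))
      (fun p => pushforward_nonneg (hc p))
    simp only [sum_pushforward, hcs] at hinf hsup
    have h1 := hpush (fun p => p.1 ⊓ p.2) (fun p => p.1 ⊓ p.2)
    have h2 := hpush (fun p => p.1 ⊔ p.2) (fun p => p.1 ⊔ p.2)
    have h3 : ∀ p, innerEntropy (M p) + innerEntropy (N p) ≤
        innerEntropy (pushforward (fun q => q.1 ⊓ q.2) (c p)) +
        innerEntropy (pushforward (fun q => q.1 ⊔ q.2) (c p)) := fun p => by
      simp only [innerEntropy, sum_pushforward, hcs, hMs, hNs]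
      linarith [hcH p]
    have h4 := sum_le_sum fun p (_ : p ∈ univ) => h3 p
    rw [sum_add_distrib, sum_add_distrib, hHμ, hHν] at h4
    rw [entropy_prod_eq μ, entropy_prod_eq ν]
    change _ ≤ entropy (pushforward (fun q : (L₁ × L₂) × (L₁ × L₂) =>
      (q.1.1 ⊓ q.2.1, q.1.2 ⊓ q.2.2)) C) + entropy (pushforward
        (fun q : (L₁ × L₂) × (L₁ × L₂) => (q.1.1 ⊔ q.2.1, q.1.2 ⊔ q.2.2)) C)
    rw [h1, h2]
    linarith

theorem of_orderIso {L L' : Type*} [Lattice L] [Fintype L] [Lattice L'] [Fintype L']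
    (e : L ≃o L') (H : EntropicFourFunctions L) : EntropicFourFunctions L' := by
  classical
  intro μ ν hμ hν h
  obtain ⟨c, hc, hcμ, hcν, hcH⟩ := H (fun x => μ (e x)) (fun x => ν (e x)) (fun x => hμ _)
    (fun x => hν _) 
    ((e.toEquiv.sum_comp μ).trans (h.trans (e.toEquiv.sum_comp ν).symm))
  have hpush : ∀ (f : L × L → L) (f' : L' × L' → L'), (∀ p, e (f p) = f' (e p.1, e p.2)) →
      ∀ x, pushforward f' (fun p => c (e.symm p.1, e.symm p.2)) (e x) = pushforward f c x := by
    intro f f' hf x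
    simp only [pushforward]
    rw [← Equiv.sum_comp (Equiv.prodCongr e.toEquiv e.toEquiv)]
    refine sum_congr rfl fun p _ => ?_
    have : f' (e p.1, e p.2) = e x ↔ f p = x := by rw [← hf, e.injective.eq_iff]
    change (if f' (e p.1, e p.2) = e x then c (e.symm (e p.1), e.symm (e p.2)) else 0) = _
    simp only [this, OrderIso.symm_apply_apply]
  have hent : ∀ τ : L' → ℝ, entropy (fun x => τ (e x)) = entropy τ := fun τ =>
    e.toEquiv.sum_comp fun x => negMulLog (τ x)
  refine ⟨fun p => c (e.symm p.1, e.symm p.2), fun p => hc _, ?_, ?_, ?_⟩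
  · funext y
    obtain ⟨x, rfl⟩ := e.surjective y
    rw [hpush Prod.fst Prod.fst (by simp), hcμ]
  · funext y
    obtain ⟨x, rfl⟩ := e.surjective y
    rw [hpush Prod.snd Prod.snd (by simp), hcν]
  · rw [hent, hent] at hcH
    rw [← hent (pushforward (fun p : L' × L' => p.1 ⊓ p.2) _),
      ← hent (pushforward (fun p : L' × L' => p.1 ⊔ p.2) _)]
    simp only [hpush (fun p => p.1 ⊓ p.2) (fun p => p.1 ⊓ p.2) (by simp),
      hpush (fun p => p.1 ⊔ p.2) (fun p => p.1 ⊔ p.2) (by simp)]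
    exact hcH

theorem of_unique (L : Type*) [Lattice L] [Fintype L] [Unique L] : EntropicFourFunctions L := by
  intro μ ν hμ hν h
  simp only [Fintype.sum_unique] at h
  refine ⟨fun p => μ p.1, fun p => hμ _, ?_, ?_, ?_⟩
  · funext x
    rw [pushforward_fst, Fintype.sum_unique]
  · funext x
    rw [pushforward_snd, Fintype.sum_unique, Subsingleton.elim x default, h]
  · have : ∀ f : L × L → L, pushforward f (fun p => μ p.1) = μ := fun f => by
      funext x
      simp [pushforward, Subsingleton.elim _ x]
    rw [this, this]
    simp [entropy, h]

theorem fin_arrow (n : ℕ) : EntropicFourFunctions (Fin n → Bool) := by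
  induction n with
  | zero => exact of_unique _
  | succ n ih => exact of_orderIso (Fin.consOrderIso fun _ : Fin (n + 1) => Bool) (bool.prod ih)

theorem arrow (ι : Type*) [Fintype ι] [DecidableEq ι] : EntropicFourFunctions (ι → Bool) := by
  have e := Fintype.equivFin ι
  exact of_orderIso
    { toEquiv := e.symm.arrowCongr (.refl Bool)
      map_rel_iff' := fun {x y} => ⟨fun h j => by simpa using h (e.symm j), fun h i => h (e i)⟩ }
    (fin_arrow _)

theorem pi_arrow {κ : Type*} (ι : κ → Type*) [Fintype κ] [DecidableEq κ] [∀ k, Fintype (ι k)]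
    [∀ k, DecidableEq (ι k)] : EntropicFourFunctions (∀ k, ι k → Bool) :=
  of_orderIso
    { toEquiv := Equiv.piCurry fun (k : κ) (_ : ι k) => Bool
      map_rel_iff' := fun {x y} => by
        refine ⟨fun h => Pi.le_def.2 fun p => ?_, fun h => Pi.le_def.2 fun k => Pi.le_def.2 fun i =>
          Pi.le_def.1 h ⟨k, i⟩⟩
        exact Pi.le_def.1 (Pi.le_def.1 h p.1) p.2 }
    (arrow (Σ k, ι k))

end EntropicFourFunctions

/-! ### Supermodular rearrangement and gluing of coordinates -/

/-- `τ'` is a rearrangement of the weight `τ` on a lattice for which the mean of every function that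
is supermodular on a sublattice containing the support of `τ` does not decrease. -/
structure SupermodularLE {L : Type*} [Lattice L] [Fintype L] (τ τ' : L → ℝ) : Prop where
  nonneg : ∀ x, 0 ≤ τ' x
  support : ∀ S : Sublattice L, (∀ x, τ x ≠ 0 → x ∈ S) → ∀ x, τ' x ≠ 0 → x ∈ S
  sum_mul_le : ∀ (S : Sublattice L) (u : L → ℝ), (∀ x, τ x ≠ 0 → x ∈ S) →
    (∀ x ∈ S, ∀ y ∈ S, u x + u y ≤ u (x ⊓ y) + u (x ⊔ y)) → ∑ x, τ x * u x ≤ ∑ x, τ' x * u x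

namespace SupermodularLE

variable {L : Type*} [Lattice L] [Fintype L] {τ τ' τ'' : L → ℝ}

theorem refl (hτ : ∀ x, 0 ≤ τ x) : SupermodularLE τ τ :=
  ⟨hτ, fun _ h => h, fun _ _ _ _ => le_rfl⟩

/-- The support clause lets the second comparison use the same sublattice as the first. -/
theorem trans (h : SupermodularLE τ τ') (h' : SupermodularLE τ' τ'') : SupermodularLE τ τ'' :=
  ⟨h'.nonneg, fun S hS => h'.support S (h.support S hS), fun S u hS hu =>
    (h.sum_mul_le S u hS hu).trans (h'.sum_mul_le S u (h.support S hS) hu)⟩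

theorem sum_mul_eq (h : SupermodularLE τ τ') {u : L → ℝ}
    (hu : ∀ x y, u x + u y = u (x ⊓ y) + u (x ⊔ y)) : ∑ x, τ x * u x = ∑ x, τ' x * u x := by
  refine le_antisymm (h.sum_mul_le ⊤ u (by simp) fun x _ y _ => (hu x y).le) ?_
  have := h.sum_mul_le ⊤ (fun x => -u x) (by simp) fun x _ y _ => by linarith [hu x y]
  simpa using this

theorem sum_eq (h : SupermodularLE τ τ') : ∑ x, τ x = ∑ x, τ' x := by
  simpa using h.sum_mul_eq (u := fun _ => 1) (by simp)

/-- Indicators of values of `a` are modular, so their means are unchanged. This keeps the incidences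
not yet glued ready for gluing. -/
theorem pushforward_eq (h : SupermodularLE τ τ') (a : LatticeHom L Bool) :
    pushforward a τ = pushforward a τ' := by
  classical
  funext b
  have : ∀ x y : Bool, ((if x = b then 1 else 0) + (if y = b then 1 else 0) : ℝ) =
      (if x ⊓ y = b then 1 else 0) + (if x ⊔ y = b then 1 else 0) := by
    intro x y
    cases x <;> cases y <;> cases b <;> simp
  have := h.sum_mul_eq (u := fun x => if a x = b then 1 else 0)
    fun x y => by simpa only [map_inf, map_sup] using this (a x) (a y)
  simp only [mul_ite, mul_one, mul_zero] at this
  simp only [pushforward]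
  convert this

end SupermodularLE

theorem entropy_add_of_disjoint {X : Type*} [Fintype X] {μ ν : X → ℝ}
    (h : ∀ x, μ x = 0 ∨ ν x = 0) : entropy (fun x => μ x + ν x) = entropy μ + entropy ν := by
  rw [entropy, entropy, entropy, ← sum_add_distrib]
  refine sum_congr rfl fun x _ => ?_
  rcases h x with h | h <;> simp [h]

/-- Subadditivity of the entropy of a pair of bits with equal marginals. -/
theorem entropy_pair_le {s q t : ℝ} (hs : 0 ≤ s) (hq : 0 ≤ q) (ht : 0 ≤ t)
    (h : s + q + (q + t) = 1) :
    negMulLog s + negMulLog q + (negMulLog q + negMulLog t) ≤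
      2 * (negMulLog (s + q) + negMulLog (q + t)) := by
  rcases (add_nonneg hs hq).eq_or_lt with h0 | h0
  · have hs0 : s = 0 := by linarith
    have hq0 : q = 0 := by linarith
    have ht1 : t = 1 := by linarith
    simp [hs0, hq0, ht1]
  rcases (add_nonneg hq ht).eq_or_lt with h1 | h1
  · have ht0 : t = 0 := by linarith
    have hq0 : q = 0 := by linarith
    have hs1 : s = 1 := by linarith
    simp [hs1, hq0, ht0]
  have key : ∀ u v w : ℝ, 0 ≤ u → 0 < v → 0 < w →
      negMulLog u ≤ v * w - u - u * (log v + log w) := fun u v w hu hv hw => by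
    have := negMulLog_le_sub_mul_log hu (mul_pos hv hw).le fun h => absurd h (mul_pos hv hw).ne'
    rwa [log_mul hv.ne' hw.ne'] at this
  have k1 := key s _ _ hs h0 h0
  have k2 := key q _ _ hq h0 h1
  have k3 := key t _ _ ht h1 h1
  -- The comparison law, two independent bits with the given marginals, has mass 1.
  have k4 : (s + q) * (s + q) + 2 * ((s + q) * (q + t)) + (q + t) * (q + t) = 1 := by
    linear_combination (s + q + (q + t) + 1) * h
  rw [negMulLog.eq_def (s + q), negMulLog.eq_def (q + t)]
  linarith

/-- A weight on a lattice for which two `Bool`-valued homomorphisms have the same law can be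
rearranged into a weight for which they agree, at the cost of at most the entropy of that law. -/
theorem exists_supermodularLE_eq {L : Type*} [Lattice L] [Fintype L]
    (H : EntropicFourFunctions L) (a b : LatticeHom L Bool) {τ : L → ℝ} (hτ : ∀ x, 0 ≤ τ x)
    (h1 : ∑ x, τ x = 1) (hab : pushforward a τ = pushforward b τ) :
    ∃ τ' : L → ℝ, SupermodularLE τ τ' ∧ (∀ x, τ' x ≠ 0 → a x = b x) ∧
      entropy τ ≤ entropy τ' + entropy (pushforward a τ) := by
  classical
  set r : Bool → Bool → L → ℝ := fun i j x => if a x = i ∧ b x = j then τ x else 0 with hr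
  have hr0 : ∀ i j x, 0 ≤ r i j x := fun i j x => by
    simp only [hr]; split_ifs <;> simp [hτ x]
  have hrab : ∀ i j x, r i j x ≠ 0 → a x = i ∧ b x = j ∧ τ x ≠ 0 := fun i j x hx => by
    simp only [hr] at hx
    split_ifs at hx with h
    · exact ⟨h.1, h.2, hx⟩
    · exact absurd rfl hx
  have hdec : ∀ x, τ x = (r false false x + r false true x) + (r true false x + r true true x) := by
    intro x
    simp only [hr]
    cases a x <;> cases b x <;> simp
  have hma : ∀ i, pushforward a τ i = ∑ x, r i false x + ∑ x, r i true x := fun i => by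
    rw [pushforward, ← sum_add_distrib]
    refine sum_congr rfl fun x _ => ?_
    simp only [hr]
    cases b x <;> simp
  have hmb : ∀ j, pushforward b τ j = ∑ x, r false j x + ∑ x, r true j x := fun j => by
    rw [pushforward, ← sum_add_distrib]
    refine sum_congr rfl fun x _ => ?_
    simp only [hr]
    cases a x <;> simp
  -- Equal laws of `a` and `b` force equal off-diagonal masses, as a coupling requires.
  have hq : ∑ x, r false true x = ∑ x, r true false x := by
    have := congrFun hab false
    rw [hma, hmb] at this
    linarith
  obtain ⟨c, hc, hc1, hc2, hcH⟩ := H (r false true) (r true false) (hr0 _ _) (hr0 _ _) hq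
  have hcs1 : ∀ p, c p ≠ 0 → r false true p.1 ≠ 0 := fun p hp h0 =>
    hp (eq_zero_of_pushforward_eq_zero hc (by rw [hc1, h0]) rfl)
  have hcs2 : ∀ p, c p ≠ 0 → r true false p.2 ≠ 0 := fun p hp h0 =>
    hp (eq_zero_of_pushforward_eq_zero hc (by rw [hc2, h0]) rfl)
  set I := pushforward (fun p : L × L => p.1 ⊓ p.2) c with hI
  set J := pushforward (fun p : L × L => p.1 ⊔ p.2) c with hJ
  have hI0 : ∀ x, 0 ≤ I x := pushforward_nonneg hc
  have hJ0 : ∀ x, 0 ≤ J x := pushforward_nonneg hc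
  have hIne : ∀ x, I x ≠ 0 → ∃ y z, y ⊓ z = x ∧ c (y, z) ≠ 0 := fun x hx => by
    obtain ⟨p, hp, hp'⟩ := exists_of_pushforward_ne_zero hx
    exact ⟨p.1, p.2, hp, hp'⟩
  have hJne : ∀ x, J x ≠ 0 → ∃ y z, y ⊔ z = x ∧ c (y, z) ≠ 0 := fun x hx => by
    obtain ⟨p, hp, hp'⟩ := exists_of_pushforward_ne_zero hx
    exact ⟨p.1, p.2, hp, hp'⟩
  have hIab : ∀ x, I x ≠ 0 → a x = false ∧ b x = false := fun x hx => by
    obtain ⟨y, z, rfl, hp⟩ := hIne x hx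
    obtain ⟨ha1, hb1, -⟩ := hrab _ _ _ (hcs1 _ hp)
    obtain ⟨ha2, hb2, -⟩ := hrab _ _ _ (hcs2 _ hp)
    simp [ha1, ha2, hb1, hb2]
  have hJab : ∀ x, J x ≠ 0 → a x = true ∧ b x = true := fun x hx => by
    obtain ⟨y, z, rfl, hp⟩ := hJne x hx
    obtain ⟨ha1, hb1, -⟩ := hrab _ _ _ (hcs1 _ hp)
    obtain ⟨ha2, hb2, -⟩ := hrab _ _ _ (hcs2 _ hp)
    simp [ha1, ha2, hb1, hb2]
  set τ0 : L → ℝ := fun x => r false false x + I x with hτ0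
  set τ1 : L → ℝ := fun x => J x + r true true x with hτ1
  have h0ne : ∀ x, τ0 x ≠ 0 → a x = false ∧ b x = false := fun x hx => by
    by_cases hIx : I x = 0
    · have := hrab false false x (by simpa [hτ0, hIx] using hx)
      exact ⟨this.1, this.2.1⟩
    · exact hIab x hIx
  have h1ne : ∀ x, τ1 x ≠ 0 → a x = true ∧ b x = true := fun x hx => by
    by_cases hJx : J x = 0
    · have := hrab true true x (by simpa [hτ1, hJx] using hx)
      exact ⟨this.1, this.2.1⟩
    · exact hJab x hJx
  refine ⟨fun x => τ0 x + τ1 x, ⟨?_, ?_, ?_⟩, ?_, ?_⟩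
  · intro x
    exact add_nonneg (add_nonneg (hr0 _ _ x) (hI0 x)) (add_nonneg (hJ0 x) (hr0 _ _ x))
  · intro S hS x hx
    by_cases hIx : I x = 0
    · by_cases hJx : J x = 0
      · by_cases hrx : r false false x = 0
        · exact hS x (hrab true true x (by simpa [hτ0, hτ1, hIx, hJx, hrx] using hx)).2.2
        · exact hS x (hrab _ _ x hrx).2.2
      · obtain ⟨y, z, rfl, hp⟩ := hJne x hJx
        exact S.sup_mem (hS _ (hrab _ _ _ (hcs1 _ hp)).2.2) (hS _ (hrab _ _ _ (hcs2 _ hp)).2.2)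
    · obtain ⟨y, z, rfl, hp⟩ := hIne x hIx
      exact S.inf_mem (hS _ (hrab _ _ _ (hcs1 _ hp)).2.2) (hS _ (hrab _ _ _ (hcs2 _ hp)).2.2)
  · intro S u hS hu
    have e1 : ∑ x, r false true x * u x = ∑ p, c p * u p.1 := by
      rw [← hc1, sum_pushforward_mul]
    have e2 : ∑ x, r true false x * u x = ∑ p, c p * u p.2 := by
      rw [← hc2, sum_pushforward_mul]
    have e3 : ∑ x, I x * u x = ∑ p, c p * u (p.1 ⊓ p.2) := sum_pushforward_mul _ _ _
    have e4 : ∑ x, J x * u x = ∑ p, c p * u (p.1 ⊔ p.2) := sum_pushforward_mul _ _ _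
    have e5 : ∑ p, c p * u p.1 + ∑ p, c p * u p.2 ≤
        ∑ p, c p * u (p.1 ⊓ p.2) + ∑ p, c p * u (p.1 ⊔ p.2) := by
      rw [← sum_add_distrib, ← sum_add_distrib]
      refine sum_le_sum fun p _ => ?_
      by_cases hp : c p = 0
      · simp [hp]
      · rw [← mul_add, ← mul_add]
        exact mul_le_mul_of_nonneg_left (hu _ (hS _ (hrab _ _ _ (hcs1 _ hp)).2.2) _
          (hS _ (hrab _ _ _ (hcs2 _ hp)).2.2)) (hc p)
    simp only [hdec, hτ0, hτ1, add_mul, sum_add_distrib]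
    linarith
  · intro x hx
    by_cases hx0 : τ0 x = 0
    · have := h1ne x (by simpa [hx0] using hx)
      rw [this.1, this.2]
    · have := h0ne x hx0
      rw [this.1, this.2]
  · have f1 : entropy τ = entropy (r false false) + entropy (r false true) +
        (entropy (r true false) + entropy (r true true)) := by
      simp only [entropy, ← sum_add_distrib]
      refine sum_congr rfl fun x _ => ?_
      simp only [hr]
      cases a x <;> cases b x <;> simp
    have f2 : entropy (fun x => τ0 x + τ1 x) = entropy τ0 + entropy τ1 :=
      entropy_add_of_disjoint fun x => by
        by_contra! h
        have := (h0ne x h.1).1.symm.trans (h1ne x h.2).1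
        simp at this
    -- Merging the pieces within 00 and within 11 costs only entropy of their masses;
    -- `entropy_pair_le` bounds that cost by the entropy of the law of `a`.
    have f3 := innerEntropy_add_le (hr0 false false) hI0
    have f4 := innerEntropy_add_le hJ0 (hr0 true true)
    have mI : ∑ x, I x = ∑ x, r true false x := by
      rw [hI, sum_pushforward, ← hc2, sum_pushforward]
    have mJ : ∑ x, J x = ∑ x, r true false x := by
      rw [hJ, sum_pushforward, ← hc2, sum_pushforward]
    simp only [innerEntropy, sum_add_distrib, mI, mJ] at f3 f4
    have f5 : entropy (pushforward a τ) =
        negMulLog (∑ x, r false false x + ∑ x, r true false x) +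
          negMulLog (∑ x, r true false x + ∑ x, r true true x) := by
      rw [entropy, Fintype.sum_bool, hma, hma, hq, add_comm]
    have f6 := entropy_pair_le (sum_nonneg fun x _ => hr0 false false x)
      (sum_nonneg fun x _ => hr0 true false x) (sum_nonneg fun x _ => hr0 true true x) (by
        rw [← h1]
        simp only [hdec, sum_add_distrib]
        rw [hq])
    rw [f1, f2, f5]
    change _ ≤ entropy τ0 + entropy τ1 + _
    linarith

/-- Iterated gluing of pairs of `Bool`-valued homomorphisms with equal laws. -/
theorem exists_supermodularLE_forall_eq {L K : Type*} [Lattice L] [Fintype L]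
    (H : EntropicFourFunctions L) (a b : K → LatticeHom L Bool) {τ : L → ℝ} (hτ : ∀ x, 0 ≤ τ x)
    (h1 : ∑ x, τ x = 1) (hab : ∀ k, pushforward (a k) τ = pushforward (b k) τ) (s : Finset K) :
    ∃ τ' : L → ℝ, SupermodularLE τ τ' ∧ (∀ k ∈ s, ∀ x, τ' x ≠ 0 → a k x = b k x) ∧
      entropy τ ≤ entropy τ' + ∑ k ∈ s, entropy (pushforward (a k) τ) := by
  classical
  induction s using Finset.induction_on with
  | empty => exact ⟨τ, .refl hτ, by simp, by simp⟩
  | insert k s hk ih =>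
    obtain ⟨τ₁, h₁, he₁, hH₁⟩ := ih
    obtain ⟨τ₂, h₂, he₂, hH₂⟩ := exists_supermodularLE_eq H (a k) (b k) h₁.nonneg
      (h₁.sum_eq.symm.trans h1) (by rw [← h₁.pushforward_eq, ← h₁.pushforward_eq, hab])
    refine ⟨τ₂, h₁.trans h₂, ?_, ?_⟩
    · intro j hj
      rcases mem_insert.1 hj with rfl | hj
      · exact he₂
      -- An agreement already reached defines a sublattice, so later gluings preserve it.
      · let S : Sublattice L :=
          { carrier := {x | a j x = b j x}
            supClosed' := fun x (hx : a j x = b j x) y (hy : a j y = b j y) => by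
              change a j (x ⊔ y) = b j (x ⊔ y)
              rw [map_sup, map_sup, hx, hy]
            infClosed' := fun x (hx : a j x = b j x) y (hy : a j y = b j y) => by
              change a j (x ⊓ y) = b j (x ⊓ y)
              rw [map_inf, map_inf, hx, hy] }
        exact h₂.support S (he₁ j hj)
    · rw [sum_insert hk]
      rw [← h₁.pushforward_eq] at hH₂
      linarith

/-! ### Product weights -/

section Product

variable {κ : Type*} [Fintype κ] [DecidableEq κ] {X : κ → Type*} [∀ k, Fintype (X k)]

theorem sum_prod_eq_one {μ : ∀ k, X k → ℝ} (h1 : ∀ k, ∑ a, μ k a = 1) :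
    ∑ x : ∀ k, X k, ∏ k, μ k (x k) = 1 := by
  rw [← Fintype.piFinset_univ, ← prod_univ_sum]
  exact prod_eq_one fun k _ => h1 k

theorem sum_prod_mul_apply {μ : ∀ k, X k → ℝ} (h1 : ∀ k, ∑ a, μ k a = 1) (k : κ) (h : X k → ℝ) :
    ∑ x : ∀ k, X k, (∏ j, μ j (x j)) * h (x k) = ∑ a, μ k a * h a := by
  classical
  -- With `h` at `k` and 1 elsewhere, the summand is a product over coordinates and the sum
  -- factorizes.
  set g : ∀ j, X j → ℝ := Function.update (fun _ _ => 1) k h with hg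
  have hgk : g k = h := by simp [hg]
  have hgj : ∀ j, j ≠ k → g j = fun _ => 1 := fun j hj => by simp [hg, hj]
  have e1 : ∀ x : ∀ k, X k, (∏ j, μ j (x j)) * h (x k) = ∏ j, μ j (x j) * g j (x j) := fun x => by
    rw [prod_mul_distrib, prod_eq_single (f := fun j => g j (x j)) k
      (fun j _ hj => by rw [hgj j hj]) (by simp), hgk]
  simp_rw [e1]
  rw [← Fintype.piFinset_univ, ← prod_univ_sum (f := fun j a => μ j a * g j a),
    prod_eq_single k (fun j _ hj => by simp [hgj j hj, h1 j]) (by simp), hgk]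

theorem entropy_pi {μ : ∀ k, X k → ℝ} (h1 : ∀ k, ∑ a, μ k a = 1) :
    entropy (fun x : ∀ k, X k => ∏ k, μ k (x k)) = ∑ k, entropy (μ k) := by
  have e1 : ∀ x : ∀ k, X k, negMulLog (∏ k, μ k (x k)) =
      ∑ k, (∏ j, μ j (x j)) * -log (μ k (x k)) := fun x => by
    by_cases hx : ∏ k, μ k (x k) = 0
    · simp [hx]
    · rw [negMulLog, log_prod (fun k _ hk => hx (prod_eq_zero (mem_univ k) hk)), ← mul_sum,
        sum_neg_distrib]
      ring
  simp only [entropy, e1]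
  rw [sum_comm]
  refine sum_congr rfl fun k _ => ?_
  rw [sum_prod_mul_apply h1 k fun a => -log (μ k a)]
  exact sum_congr rfl fun a _ => by rw [negMulLog]; ring

end Product

section ProductOfTwo

variable {X Y : Type*} [Fintype X] [Fintype Y] {P : X → ℝ} {Q : Y → ℝ}

theorem sum_mul_mul_fst (hQ : ∑ y, Q y = 1) (h : X → ℝ) :
    ∑ p : X × Y, P p.1 * Q p.2 * h p.1 = ∑ x, P x * h x := by
  rw [Fintype.sum_prod_type]
  refine sum_congr rfl fun x _ => ?_
  simp only [← sum_mul, ← mul_sum, hQ, mul_one]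

theorem sum_mul_mul_snd (hP : ∑ x, P x = 1) (h : Y → ℝ) :
    ∑ p : X × Y, P p.1 * Q p.2 * h p.2 = ∑ y, Q y * h y := by
  rw [Fintype.sum_prod_type_right]
  refine sum_congr rfl fun y _ => ?_
  simp only [← sum_mul, hP, one_mul]

theorem entropy_mul (hP : ∑ x, P x = 1) (hQ : ∑ y, Q y = 1) :
    entropy (fun p : X × Y => P p.1 * Q p.2) = entropy P + entropy Q := by
  simp only [entropy, negMulLog_mul, sum_add_distrib, Fintype.sum_prod_type, ← mul_sum, ← sum_mul,
    hP, hQ, one_mul]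

end ProductOfTwo

/-! ### From the Bethe approximation to the partition function -/

section Bethe

variable {V : Type*} {A : Finset (Finset V)}

/-- The lattice of independent assignments to the variables and to the factors. -/
abbrev Assignments (A : Finset (Finset V)) : Type _ :=
  (V → Bool) × ((α : A) → α.1 → Bool)

/-- The value of the variable of an incidence, as read off from the variables. -/
def nodeHom (k : Σ α : A, α.1) : LatticeHom (Assignments A) Bool where
  toFun p := p.1 k.2
  map_sup' _ _ := rfl
  map_inf' _ _ := rfl

/-- The value of the variable of an incidence, as read off from the factor. -/
def factorHom (k : Σ α : A, α.1) : LatticeHom (Assignments A) Bool where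
  toFun p := p.2 k.1 k.2
  map_sup' _ _ := rfl
  map_inf' _ _ := rfl

theorem eq_zero_of_node_eq_zero [DecidableEq V] {τ : Beliefs A} (hτ : τ ∈ localPolytope A) {α : A}
    {x : α.1 → Bool} (i : α.1) (h : τ.1 i (x i) = 0) : τ.2 α x = 0 := by
  obtain ⟨-, h2, -, -, h5⟩ := hτ
  have := h5 α i (x i)
  rw [h] at this
  exact (sum_eq_zero_iff_of_nonneg fun y _ => h2 α y).1 this x (by simp)

theorem sum_factor_mul_apply [DecidableEq V] {τ : Beliefs A} (hτ : τ ∈ localPolytope A) (α : A) (i : α.1)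
    (h : Bool → ℝ) : ∑ x, τ.2 α x * h (x i) = ∑ b, τ.1 i b * h b := by
  obtain ⟨-, -, -, -, h5⟩ := hτ
  simp only [← h5 α i, sum_mul]
  rw [← sum_fiberwise univ fun x : α.1 → Bool => x i]
  refine sum_congr rfl fun b _ => sum_congr rfl fun x hx => ?_
  rw [(mem_filter.1 hx).2]

variable [Fintype V]

/-- The beliefs vanish where the potentials do. -/
def IsSupported {f : (V → Bool) → ℝ≥0} (F : Factorization A f) (τ : Beliefs A) : Prop :=
  (∀ i b, F.φ i b = 0 → τ.1 i b = 0) ∧ ∀ α x, F.ψ α x = 0 → τ.2 α x = 0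

/-- The logarithm of the product of all potentials at independent assignments. -/
noncomputable def energy {f : (V → Bool) → ℝ≥0} (F : Factorization A f) (p : Assignments A) : ℝ :=
  ∑ i, log (F.φ i (p.1 i)) + ∑ α : A, log (F.ψ α (p.2 α))

theorem LogSupermodular.ne_zero {ι : Type*} {g : (ι → Bool) → ℝ≥0} (hg : LogSupermodular g)
    {x y : ι → Bool} (hx : g x ≠ 0) (hy : g y ≠ 0) : g (x ⊓ y) ≠ 0 ∧ g (x ⊔ y) ≠ 0 :=
  mul_ne_zero_iff.1 ((pos_iff_ne_zero.2 (mul_ne_zero hx hy)).trans_le (hg x y)).ne'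

theorem LogSupermodular.log_add_log_le {ι : Type*} {g : (ι → Bool) → ℝ≥0}
    (hg : LogSupermodular g) {x y : ι → Bool} (hx : g x ≠ 0) (hy : g y ≠ 0) :
    log (g x) + log (g y) ≤ log (g (x ⊓ y)) + log (g (x ⊔ y)) := by
  obtain ⟨h1, h2⟩ := hg.ne_zero hx hy
  rw [← log_mul (by exact_mod_cast hx) (by exact_mod_cast hy),
    ← log_mul (by exact_mod_cast h1) (by exact_mod_cast h2)]
  refine log_le_log (by positivity) ?_
  exact_mod_cast hg x y

/-- The assignments at which no potential vanishes. -/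
def supportSublattice {f : (V → Bool) → ℝ≥0} {F : Factorization A f} (hF : F.IsLogSupermodular) :
    Sublattice (Assignments A) where
  carrier := {p | (∀ i, F.φ i (p.1 i) ≠ 0) ∧ ∀ α, F.ψ α (p.2 α) ≠ 0}
  supClosed' := fun p hp q hq => by
    refine ⟨fun i => ?_, fun α => ((hF α).ne_zero (hp.2 α) (hq.2 α)).2⟩
    rcases max_choice (p.1 i) (q.1 i) with h | h
    · exact (congrArg (F.φ i) h).trans_ne (hp.1 i)
    · exact (congrArg (F.φ i) h).trans_ne (hq.1 i)
  infClosed' := fun p hp q hq => by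
    refine ⟨fun i => ?_, fun α => ((hF α).ne_zero (hp.2 α) (hq.2 α)).1⟩
    rcases min_choice (p.1 i) (q.1 i) with h | h
    · exact (congrArg (F.φ i) h).trans_ne (hp.1 i)
    · exact (congrArg (F.φ i) h).trans_ne (hq.1 i)

/-- Node terms are modular, being functions on a chain; factor terms are supermodular. Off the
support this can fail, since the real logarithm of 0 is 0. -/
theorem energy_add_le {f : (V → Bool) → ℝ≥0} {F : Factorization A f} (hF : F.IsLogSupermodular)
    {p q : Assignments A} (hp : p ∈ supportSublattice hF) (hq : q ∈ supportSublattice hF) :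
    energy F p + energy F q ≤ energy F (p ⊓ q) + energy F (p ⊔ q) := by
  have e1 : ∀ (g : Bool → ℝ) (b c : Bool), g b + g c = g (b ⊓ c) + g (b ⊔ c) := by
    intro g b c
    cases b <;> cases c <;> simp [add_comm]
  have e2 : ∑ i, log (F.φ i (p.1 i)) + ∑ i, log (F.φ i (q.1 i)) =
      ∑ i, log (F.φ i ((p ⊓ q).1 i)) + ∑ i, log (F.φ i ((p ⊔ q).1 i)) := by
    rw [← sum_add_distrib, ← sum_add_distrib]
    exact sum_congr rfl fun i _ => e1 (fun b => log (F.φ i b)) (p.1 i) (q.1 i)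
  have e3 : ∑ α : A, log (F.ψ α (p.2 α)) + ∑ α : A, log (F.ψ α (q.2 α)) ≤
      ∑ α : A, log (F.ψ α ((p ⊓ q).2 α)) + ∑ α : A, log (F.ψ α ((p ⊔ q).2 α)) := by
    rw [← sum_add_distrib, ← sum_add_distrib]
    exact sum_le_sum fun α _ => (hF α).log_add_log_le (hp.2 α) (hq.2 α)
  simp only [energy]
  linarith

variable [DecidableEq V]

/-- The weight that makes all variables and all factors independent. -/
noncomputable def productBelief (τ : Beliefs A) (p : Assignments A) : ℝ :=
  (∏ i, τ.1 i (p.1 i)) * ∏ α : A, τ.2 α (p.2 α)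

theorem betheEntropy_eq {τ : Beliefs A} (hτ : τ ∈ localPolytope A) :
    betheEntropy τ = ∑ i, entropy (τ.1 i) +
      ∑ α : A, (entropy (τ.2 α) - ∑ i : α.1, entropy (τ.1 i)) := by
  rw [betheEntropy, sub_eq_add_neg, ← sum_neg_distrib, ← sum_neg_distrib]
  congr 1
  · refine sum_congr rfl fun i _ => ?_
    simp [entropy, negMulLog]
  refine sum_congr rfl fun α _ => ?_
  have e1 : ∀ x, τ.2 α x * log (τ.2 α x / ∏ i : α.1, τ.1 i (x i)) =
      -negMulLog (τ.2 α x) - ∑ i : α.1, τ.2 α x * log (τ.1 i (x i)) := fun x => by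
    by_cases hx : τ.2 α x = 0
    · simp [hx]
    have hi : ∀ i ∈ (univ : Finset α.1), τ.1 i (x i) ≠ 0 := fun i _ h =>
      hx (eq_zero_of_node_eq_zero hτ i h)
    rw [log_div hx (prod_ne_zero_iff.2 hi), log_prod hi, ← mul_sum, negMulLog]
    ring
  simp only [e1, sum_sub_distrib, sum_neg_distrib]
  rw [sum_comm]
  have e2 : ∀ i : α.1, ∑ x, τ.2 α x * log (τ.1 i (x i)) = -entropy (τ.1 i) := fun i => by
    rw [sum_factor_mul_apply hτ α i fun b => log (τ.1 i b)]
    simp [entropy, negMulLog]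
  simp only [e2, sum_neg_distrib, entropy]
  ring

/-- Against `betheEntropy_eq`, the surplus is one node entropy per incidence: exactly the budget for
gluing. -/
theorem entropy_productBelief {τ : Beliefs A} (hτ : τ ∈ localPolytope A) :
    entropy (productBelief τ) = ∑ i, entropy (τ.1 i) + ∑ α : A, entropy (τ.2 α) := by
  obtain ⟨-, -, h3, h4, -⟩ := hτ
  have := entropy_mul (sum_prod_eq_one h3) (sum_prod_eq_one h4)
  rw [entropy_pi h3, entropy_pi h4] at this
  exact this

theorem sum_productBelief {τ : Beliefs A} (hτ : τ ∈ localPolytope A) :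
    ∑ p, productBelief τ p = 1 := by
  obtain ⟨-, -, h3, h4, -⟩ := hτ
  simp only [productBelief, Fintype.sum_prod_type, ← mul_sum, sum_prod_eq_one h3,
    sum_prod_eq_one h4, mul_one]

theorem sum_productBelief_mul_node {τ : Beliefs A} (hτ : τ ∈ localPolytope A) (i : V)
    (h : Bool → ℝ) : ∑ p, productBelief τ p * h (p.1 i) = ∑ b, τ.1 i b * h b := by
  obtain ⟨-, -, h3, h4, -⟩ := hτ
  exact (sum_mul_mul_fst (sum_prod_eq_one h4) fun x : V → Bool => h (x i)).trans (sum_prod_mul_apply h3 i h)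

theorem sum_productBelief_mul_factor {τ : Beliefs A} (hτ : τ ∈ localPolytope A) (α : A)
    (h : (α.1 → Bool) → ℝ) : ∑ p, productBelief τ p * h (p.2 α) = ∑ x, τ.2 α x * h x := by
  obtain ⟨-, -, h3, h4, -⟩ := hτ
  exact (sum_mul_mul_snd (sum_prod_eq_one h3) fun y : (α : A) → α.1 → Bool => h (y α)).trans
    (sum_prod_mul_apply h4 α h)

theorem pushforward_nodeHom {τ : Beliefs A} (hτ : τ ∈ localPolytope A) (k : Σ α : A, α.1) :
    pushforward (nodeHom k) (productBelief τ) = τ.1 k.2 := by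
  classical
  funext b
  have := sum_productBelief_mul_node hτ k.2 fun c => if c = b then 1 else 0
  simp only [mul_ite, mul_one, mul_zero, sum_ite_eq', mem_univ, if_true] at this
  rw [← this, pushforward]
  exact sum_congr rfl fun p _ => by congr

theorem pushforward_factorHom {τ : Beliefs A} (hτ : τ ∈ localPolytope A) (k : Σ α : A, α.1) :
    pushforward (factorHom k) (productBelief τ) = τ.1 k.2 := by
  classical
  funext b
  have := sum_productBelief_mul_factor hτ k.1 fun x => if x k.2 = b then 1 else 0
  rw [sum_factor_mul_apply hτ k.1 k.2 fun c => if c = b then 1 else 0] at this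
  simp only [mul_ite, mul_one, mul_zero, sum_ite_eq', mem_univ, if_true] at this
  rw [← this, pushforward]
  exact sum_congr rfl fun p _ => by congr

/-- The Gibbs variational principle for weights on consistent assignments. -/
theorem entropy_add_sum_energy_le {f : (V → Bool) → ℝ≥0} (F : Factorization A f)
    {τ : Assignments A → ℝ} (hτ : ∀ p, 0 ≤ τ p) (h1 : ∑ p, τ p = 1)
    (hφ : ∀ p, τ p ≠ 0 → ∀ i, F.φ i (p.1 i) ≠ 0) (hψ : ∀ p, τ p ≠ 0 → ∀ α, F.ψ α (p.2 α) ≠ 0)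
    (hd : ∀ p, τ p ≠ 0 → p.2 = fun (α : A) (i : α.1) => p.1 i) :
    0 < partitionFunction f ∧
      entropy τ + ∑ p, τ p * energy F p ≤ log (partitionFunction f : ℝ) := by
  classical
  have hf : ∀ p, τ p ≠ 0 → f p.1 ≠ 0 ∧ energy F p = log (f p.1) := fun p hp => by
    have hα : ∀ α ∈ (univ : Finset A), F.ψ α (fun i => p.1 i) ≠ 0 := fun α _ => by
      have := hψ p hp α
      rwa [hd p hp] at this
    have hi : ∀ i ∈ (univ : Finset V), F.φ i (p.1 i) ≠ 0 := fun i _ => hφ p hp i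
    rw [F.eq_prod]
    refine ⟨mul_ne_zero (prod_ne_zero_iff.2 hi) (prod_ne_zero_iff.2 hα), ?_⟩
    rw [NNReal.coe_mul, NNReal.coe_prod, NNReal.coe_prod, log_mul, log_prod, log_prod, energy,
      hd p hp]
    · exact fun α h => by exact_mod_cast hα α h
    · exact fun i h => by exact_mod_cast hi i h
    · exact prod_ne_zero_iff.2 fun i h => by exact_mod_cast hi i h
    · exact prod_ne_zero_iff.2 fun α h => by exact_mod_cast hα α h
  obtain ⟨p₀, -, hp₀⟩ := exists_ne_zero_of_sum_ne_zero (h1.trans_ne one_ne_zero)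
  have hZ : 0 < partitionFunction f :=
    sum_pos' (fun _ _ => zero_le) ⟨p₀.1, mem_univ _, pos_iff_ne_zero.2 (hf p₀ hp₀).1⟩
  have hZ' : (0 : ℝ) < partitionFunction f := by exact_mod_cast hZ
  refine ⟨hZ, ?_⟩
  -- The Gibbs law f / Z carried by the consistent assignments.
  set v : Assignments A → ℝ := fun p =>
    if p.2 = fun (α : A) (i : α.1) => p.1 i then f p.1 / partitionFunction f else 0 with hv
  have hv1 : ∑ p, v p = 1 := by
    rw [Fintype.sum_prod_type]
    simp only [hv, sum_ite_eq', mem_univ, if_true]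
    rw [← sum_div, partitionFunction, NNReal.coe_sum, div_self]
    rw [← NNReal.coe_sum]
    exact hZ'.ne'
  have key : ∀ p, negMulLog (τ p) + τ p * energy F p ≤
      v p - τ p + τ p * log (partitionFunction f) := fun p => by
    by_cases hp : τ p = 0
    · simp only [hp, negMulLog_zero, zero_mul, add_zero, sub_zero, hv]
      split_ifs <;> positivity
    obtain ⟨h2, h3⟩ := hf p hp
    have h2' : (0 : ℝ) < f p.1 := by positivity
    have hvp : v p = f p.1 / partitionFunction f := if_pos (hd p hp)
    have hvpos : 0 < v p := by rw [hvp]; positivity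
    have := negMulLog_le_sub_mul_log (hτ p) hvpos.le fun h => absurd h hvpos.ne'
    rw [hvp, log_div h2'.ne' hZ'.ne', ← hvp] at this
    rw [h3]
    linarith
  have := sum_le_sum fun p (_ : p ∈ univ) => key p
  rw [sum_add_distrib, sum_add_distrib, sum_sub_distrib, ← sum_mul, hv1, h1] at this
  rw [entropy]
  linarith

/-- The logarithm of the Bethe approximation as a real number, for beliefs that are supported where
the potentials do not vanish. -/
noncomputable def realLogBethe {f : (V → Bool) → ℝ≥0} (F : Factorization A f) (τ : Beliefs A) : ℝ :=
  (∑ i, ∑ b, τ.1 i b * log (F.φ i b)) + (∑ α : A, ∑ x, τ.2 α x * log (F.ψ α x)) + betheEntropy τ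

theorem sum_productBelief_mul_energy {f : (V → Bool) → ℝ≥0} (F : Factorization A f)
    {τ : Beliefs A} (hτ : τ ∈ localPolytope A) :
    ∑ p, productBelief τ p * energy F p =
      (∑ i, ∑ b, τ.1 i b * log (F.φ i b)) + ∑ α : A, ∑ x, τ.2 α x * log (F.ψ α x) := by
  simp only [energy, mul_add, mul_sum, sum_add_distrib]
  congr 1
  · rw [sum_comm]
    exact sum_congr rfl fun i _ => sum_productBelief_mul_node hτ i fun b => log (F.φ i b)
  · rw [sum_comm]
    exact sum_congr rfl fun α _ => sum_productBelief_mul_factor hτ α fun x => log (F.ψ α x)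

theorem realLogBethe_le {f : (V → Bool) → ℝ≥0} {F : Factorization A f} (hF : F.IsLogSupermodular)
    {τ : Beliefs A} (hτ : τ ∈ localPolytope A) (hs : IsSupported F τ) :
    0 < partitionFunction f ∧ realLogBethe F τ ≤ log (partitionFunction f : ℝ) := by
  have hH : EntropicFourFunctions (Assignments A) :=
    (EntropicFourFunctions.arrow V).prod (EntropicFourFunctions.pi_arrow _)
  have h0 : ∀ p, 0 ≤ productBelief τ p := fun p =>
    mul_nonneg (prod_nonneg fun i _ => hτ.1 i _) (prod_nonneg fun α _ => hτ.2.1 α _)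
  -- Glue every incidence; the result lives on consistent assignments.
  obtain ⟨τ', h, he, hent⟩ := exists_supermodularLE_forall_eq hH nodeHom factorHom h0
    (sum_productBelief hτ)
    (fun k => (pushforward_nodeHom hτ k).trans (pushforward_factorHom hτ k).symm) univ
  have hS : ∀ p, productBelief τ p ≠ 0 → p ∈ supportSublattice hF := fun p hp => by
    obtain ⟨h2, h3⟩ := mul_ne_zero_iff.1 hp
    exact ⟨fun i hi => prod_ne_zero_iff.1 h2 i (mem_univ i) (hs.1 i _ hi),
      fun α hα => prod_ne_zero_iff.1 h3 α (mem_univ α) (hs.2 α _ hα)⟩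
  have hS' := h.support _ hS
  have hE := h.sum_mul_le _ (energy F) hS fun p hp q hq => energy_add_le hF hp hq
  obtain ⟨hZ, hG⟩ := entropy_add_sum_energy_le F h.nonneg (h.sum_eq.symm.trans (sum_productBelief hτ))
    (fun p hp => (hS' p hp).1) (fun p hp => (hS' p hp).2)
    (fun p hp => funext fun α => funext fun i => (he ⟨α, i⟩ (mem_univ _) p hp).symm)
  refine ⟨hZ, ?_⟩
  rw [entropy_productBelief hτ] at hent
  simp only [pushforward_nodeHom hτ, Fintype.sum_sigma] at hent
  rw [sum_productBelief_mul_energy F hτ] at hE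
  rw [realLogBethe, betheEntropy_eq hτ, sum_sub_distrib]
  linarith

end Bethe

/-! ### Beliefs at fixed points of belief propagation -/

namespace IsNormalizationOf

variable {X : Type*} [Fintype X] {p q : X → ℝ}

theorem sum_eq_one (h : IsNormalizationOf p q) : ∑ x, p x = 1 := by
  simp only [h.2]
  rw [← sum_div, div_self h.1.ne']

theorem nonneg (h : IsNormalizationOf p q) (hq : ∀ x, 0 ≤ q x) (x : X) : 0 ≤ p x := by
  rw [h.2]
  exact div_nonneg (hq x) h.1.le

theorem eq_mul_sum (h : IsNormalizationOf p q) (x : X) : q x = p x * ∑ y, q y := by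
  rw [h.2, div_mul_cancel₀ _ h.1.ne']

end IsNormalizationOf

section BeliefPropagation

variable {V : Type*} [Fintype V] [DecidableEq V] {A : Finset (Finset V)} {f : (V → Bool) → ℝ≥0}
  {F : Factorization A f} {m m' : A → V → Bool → ℝ} {τ : Beliefs A}

/-- The unnormalized marginals of a factor belief at a fixed point of belief propagation are
proportional to the node belief. -/
theorem IsBPFixedPoint.exists_sum_factor_eq (hm : IsBPFixedPoint F m m') (hτ : IsBPBelief F m m' τ)
    (α : A) (i : α.1) : ∃ C : ℝ, ∀ b, ∑ x with x i = b, τ.2 α x = C * τ.1 i b := by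
  set S := ∑ x : α.1 → Bool, (F.ψ α x : ℝ) * ∏ j : α.1, m α j (x j) with hS
  set R := ∑ b, ∑ x : α.1 → Bool with x i = b,
    (F.ψ α x : ℝ) * ∏ j : α.1 with j ≠ i, m α j (x j) with hR
  set Q := ∑ b, (F.φ i b : ℝ) * ∏ β : A with i.1 ∈ β.1 ∧ β ≠ α, m' β i b with hQ
  set N := ∑ b, (F.φ i b : ℝ) * ∏ β : A with i.1 ∈ β.1, m' β i b with hN
  -- The factor update makes the marginal m · m' · R / S (`h1`); the variable update makes the node
  -- belief Q · m · m' / N (`h2`).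
  refine ⟨N * R / Q / S, fun b => ?_⟩
  have h1 : ∑ x with x i = b, τ.2 α x = (m α i b * (m' α i b * R)) / S := by
    rw [← (hm.factor_to_var α i).eq_mul_sum b, mul_sum, sum_div]
    refine sum_congr rfl fun x hx => ?_
    have e : ∏ j : α.1, m α j (x j) = m α i b * ∏ j : α.1 with j ≠ i, m α j (x j) := by
      rw [← mul_prod_erase univ _ (mem_univ i), (mem_filter.1 hx).2]
      congr 1
      exact prod_congr (by ext; simp) fun _ _ => rfl
    have e' : τ.2 α x = (F.ψ α x * ∏ j : α.1, m α j (x j)) / S := (hτ.factor α).2 x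
    rw [e', e]
    ring
  have h2 : τ.1 i b * N = Q * (m α i b * m' α i b) := by
    rw [← (hτ.node i).eq_mul_sum b, ← mul_assoc, mul_comm Q, ← (hm.var_to_factor α i).eq_mul_sum b,
      mul_assoc]
    congr 1
    rw [← prod_erase_mul _ _ (show α ∈ univ.filter fun β : A => i.1 ∈ β.1 by simp)]
    congr 1
    exact prod_congr (by ext; simp [and_comm]) fun _ _ => rfl
  have hQ0 : Q ≠ 0 := (hm.var_to_factor α i).1.ne'
  have hS0 : S ≠ 0 := (hτ.factor α).1.ne'
  rw [h1]
  field_simp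
  linear_combination (-R) * h2

theorem IsBPFixedPoint.mem_localPolytope (hm : IsBPFixedPoint F m m') (hτ : IsBPBelief F m m' τ) :
    τ ∈ localPolytope A := by
  refine ⟨fun i b => (hτ.node i).nonneg (fun b => ?_) b,
    fun α x => (hτ.factor α).nonneg (fun x => ?_) x, fun i => (hτ.node i).sum_eq_one,
    fun α => (hτ.factor α).sum_eq_one, fun α i b => ?_⟩
  · exact mul_nonneg (F.φ i b).2 (prod_nonneg fun α hα => hm.nonneg' α ⟨i, (mem_filter.1 hα).2⟩ b)
  · exact mul_nonneg (F.ψ α x).2 (prod_nonneg fun j _ => hm.nonneg α j _)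
  -- Both sides have total mass 1, so `C = 1`.
  · obtain ⟨C, hC⟩ := hm.exists_sum_factor_eq hτ α i
    have h1 := sum_congr rfl fun b (_ : b ∈ univ) => hC b
    rw [sum_fiberwise univ (fun x : α.1 → Bool => x i), ← mul_sum, (hτ.factor α).sum_eq_one,
      (hτ.node i).sum_eq_one, mul_one] at h1
    rw [hC, ← h1, one_mul]

end BeliefPropagation

/-! ### Zero potentials and attainment of the maximum -/

section BetheValue

theorem localPolytope_nonempty {V : Type*} [DecidableEq V] {A : Finset (Finset V)} :
    (localPolytope A).Nonempty := by
  refine ⟨(fun _ b => if b = false then 1 else 0, fun _ x => if x = fun _ => false then 1 else 0),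
    fun i b => ?_, fun α x => ?_, fun i => ?_, fun α => ?_, fun α i b => ?_⟩
  · dsimp only; split_ifs <;> simp
  · dsimp only; split_ifs <;> simp
  · simp
  · simp
  · simp [sum_ite_eq', eq_comm]

variable {V : Type*} [Fintype V] [DecidableEq V] {A : Finset (Finset V)} {f : (V → Bool) → ℝ≥0}
  {F : Factorization A f} {τ : Beliefs A}

theorem coe_mul_ennrealLog {t : ℝ} {a : ℝ≥0} (h : a = 0 → t = 0) :
    (t : EReal) * ENNReal.log (a : ℝ≥0∞) = ((t * log a : ℝ) : EReal) := by
  by_cases ha : a = 0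
  · simp [h ha]
  · rw [ENNReal.log_pos_real (by simpa using ha) (by simp), EReal.coe_mul]
    simp

theorem coe_finset_sum_ereal {ι : Type*} (s : Finset ι) (g : ι → ℝ) :
    ((∑ i ∈ s, g i : ℝ) : EReal) = ∑ i ∈ s, (g i : EReal) :=
  map_sum (⟨⟨Real.toEReal, EReal.coe_zero⟩, EReal.coe_add⟩ : ℝ →+ EReal) g s

theorem sum_ereal_eq_bot {ι : Type*} {s : Finset ι} {g : ι → EReal} {i : ι} (hi : i ∈ s)
    (h : g i = ⊥) : ∑ i ∈ s, g i = ⊥ := by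
  classical
  rw [← add_sum_erase s g hi, h, EReal.bot_add]

theorem logBethe_of_isSupported (hs : IsSupported F τ) :
    logBethe F τ = (realLogBethe F τ : EReal) := by
  simp only [logBethe, realLogBethe, EReal.coe_add, coe_finset_sum_ereal]
  congr 2
  · exact sum_congr rfl fun i _ => sum_congr rfl fun b _ => coe_mul_ennrealLog (hs.1 i b)
  · exact sum_congr rfl fun α _ => sum_congr rfl fun x _ => coe_mul_ennrealLog (hs.2 α x)

theorem logBethe_of_not_isSupported (hτ : τ ∈ localPolytope A) (hs : ¬ IsSupported F τ) :
    logBethe F τ = ⊥ := by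
  rw [IsSupported, not_and_or] at hs
  push Not at hs
  rcases hs with ⟨i, b, h, h'⟩ | ⟨α, x, h, h'⟩
  · have e : (τ.1 i b : EReal) * ENNReal.log (F.φ i b : ℝ≥0∞) = ⊥ := by
      rw [h, ENNReal.coe_zero, ENNReal.log_zero]
      exact EReal.coe_mul_bot_of_pos ((hτ.1 i b).lt_of_ne h'.symm)
    rw [logBethe, sum_ereal_eq_bot (mem_univ i) (sum_ereal_eq_bot (mem_univ b) e), EReal.bot_add,
      EReal.bot_add]
  · have e : (τ.2 α x : EReal) * ENNReal.log (F.ψ α x : ℝ≥0∞) = ⊥ := by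
      rw [h, ENNReal.coe_zero, ENNReal.log_zero]
      exact EReal.coe_mul_bot_of_pos ((hτ.2.1 α x).lt_of_ne h'.symm)
    rw [logBethe, sum_ereal_eq_bot (mem_univ α) (sum_ereal_eq_bot (mem_univ x) e), EReal.add_bot,
      EReal.bot_add]

theorem betheValue_of_not_isSupported (hτ : τ ∈ localPolytope A) (hs : ¬ IsSupported F τ) :
    betheValue F τ = 0 := by
  rw [betheValue, logBethe_of_not_isSupported hτ hs, EReal.exp_bot]

theorem betheValue_le (hF : F.IsLogSupermodular) (hτ : τ ∈ localPolytope A) :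
    betheValue F τ ≤ (partitionFunction f : ℝ≥0∞) := by
  by_cases hs : IsSupported F τ
  · obtain ⟨hZ, hle⟩ := realLogBethe_le hF hτ hs
    rw [betheValue, logBethe_of_isSupported hs, EReal.exp_coe]
    refine ENNReal.ofReal_le_of_le_toReal ?_
    rw [ENNReal.coe_toReal, ← le_log_iff_exp_le (by exact_mod_cast hZ)]
    exact hle
  · rw [betheValue_of_not_isSupported hτ hs]
    exact zero_le

theorem isClosed_setOf_isSupported (F : Factorization A f) :
    IsClosed {τ : Beliefs A | τ ∈ localPolytope A ∧ IsSupported F τ} := by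
  have c1 : ∀ i b, Continuous fun τ : Beliefs A => τ.1 i b := fun i b => by fun_prop
  have c2 : ∀ α x, Continuous fun τ : Beliefs A => τ.2 α x := fun α x => by fun_prop
  simp only [localPolytope, IsSupported, Set.ofPred_and, Set.ofPred_forall]
  refine .inter (.inter ?_ (.inter ?_ (.inter ?_ (.inter ?_ ?_)))) (.inter ?_ ?_)
  · exact isClosed_iInter fun i => isClosed_iInter fun b => isClosed_le continuous_const (c1 i b)
  · exact isClosed_iInter fun α => isClosed_iInter fun x => isClosed_le continuous_const (c2 α x)
  · exact isClosed_iInter fun i => isClosed_eq (continuous_finsetSum _ fun b _ => c1 i b)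
      continuous_const
  · exact isClosed_iInter fun α => isClosed_eq (continuous_finsetSum _ fun x _ => c2 α x)
      continuous_const
  · exact isClosed_iInter fun α => isClosed_iInter fun i => isClosed_iInter fun b =>
      isClosed_eq (continuous_finsetSum _ fun x _ => c2 α x) (c1 i b)
  · exact isClosed_iInter fun i => isClosed_iInter fun b => isClosed_iInter fun _ =>
      isClosed_eq (c1 i b) continuous_const
  · exact isClosed_iInter fun α => isClosed_iInter fun x => isClosed_iInter fun _ =>
      isClosed_eq (c2 α x) continuous_const

theorem isCompact_setOf_isSupported (F : Factorization A f) :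
    IsCompact {τ : Beliefs A | τ ∈ localPolytope A ∧ IsSupported F τ} := by
  refine (isCompact_Icc (a := (0 : Beliefs A)) (b := 1)).of_isClosed_subset
    (isClosed_setOf_isSupported F) ?_
  rintro τ ⟨⟨h1, h2, h3, h4, -⟩, -⟩
  refine ⟨⟨h1, h2⟩, ⟨fun i b => ?_, fun α x => ?_⟩⟩
  · exact (single_le_sum (fun b _ => h1 i b) (mem_univ b)).trans_eq (h3 i)
  · exact (single_le_sum (fun x _ => h2 α x) (mem_univ x)).trans_eq (h4 α)

/-- On the polytope the quotients inside the logarithms can be eliminated, leaving the everywhere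
continuous `negMulLog`. -/
theorem continuousOn_realLogBethe (F : Factorization A f) :
    ContinuousOn (realLogBethe F) (localPolytope A) := by
  have : Continuous fun τ : Beliefs A => (∑ i, ∑ b, τ.1 i b * log (F.φ i b)) +
      (∑ α : A, ∑ x, τ.2 α x * log (F.ψ α x)) + (∑ i, entropy (τ.1 i) +
      ∑ α : A, (entropy (τ.2 α) - ∑ i : α.1, entropy (τ.1 i))) := by
    have h1 : ∀ i : V, Continuous fun τ : Beliefs A => entropy (τ.1 i) := fun i =>
      continuous_finsetSum _ fun b _ => continuous_negMulLog.comp (by fun_prop)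
    have h2 : ∀ α : A, Continuous fun τ : Beliefs A => entropy (τ.2 α) := fun α =>
      continuous_finsetSum _ fun x _ => continuous_negMulLog.comp (by fun_prop)
    fun_prop
  refine this.continuousOn.congr fun τ hτ => ?_
  rw [realLogBethe, betheEntropy_eq hτ]

theorem exists_isMax_betheValue (F : Factorization A f) :
    ∃ τ ∈ localPolytope A, ∀ σ ∈ localPolytope A, betheValue F σ ≤ betheValue F τ := by
  by_cases hne : {τ : Beliefs A | τ ∈ localPolytope A ∧ IsSupported F τ}.Nonempty
  · obtain ⟨τ, ⟨hτ, hs⟩, hmax⟩ := (isCompact_setOf_isSupported F).exists_isMaxOn hne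
      ((continuousOn_realLogBethe F).mono fun _ h => h.1)
    refine ⟨τ, hτ, fun σ hσ => ?_⟩
    by_cases hσs : IsSupported F σ
    · rw [betheValue, betheValue, logBethe_of_isSupported hs, logBethe_of_isSupported hσs]
      exact EReal.exp_monotone (EReal.coe_le_coe_iff.2 (hmax ⟨hσ, hσs⟩))
    · rw [betheValue_of_not_isSupported hσ hσs]
      exact zero_le
  -- Here Z_B vanishes on the whole polytope, so any point is a maximizer.
  · obtain ⟨τ, hτ⟩ := localPolytope_nonempty (A := A)
    refine ⟨τ, hτ, fun σ hσ => ?_⟩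
    rw [betheValue_of_not_isSupported hσ fun h => hne ⟨σ, hσ, h⟩]
    exact zero_le

end BetheValue

end BetheLSM

theorem mainTheorem1 {V : Type*} [Fintype V] [DecidableEq V] (A : Finset (Finset V))
    (f : (V → Bool) → ℝ≥0) (F : BetheLSM.Factorization A f) (hF : F.IsLogSupermodular) :
    (∃ τ ∈ BetheLSM.localPolytope A,
        BetheLSM.betheValue F τ = BetheLSM.bethePartitionFunction F) ∧
      BetheLSM.bethePartitionFunction F ≤ (BetheLSM.partitionFunction f : ℝ≥0∞) ∧
      (∀ (m m' : A → V → Bool → ℝ) (τ : BetheLSM.Beliefs A),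
        BetheLSM.IsBPFixedPoint F m m' → BetheLSM.IsBPBelief F m m' τ →
          τ ∈ BetheLSM.localPolytope A ∧
            BetheLSM.betheValue F τ ≤ (BetheLSM.partitionFunction f : ℝ≥0∞)) := by
  refine ⟨?_, iSup₂_le fun τ hτ => BetheLSM.betheValue_le hF hτ, fun m m' τ hm hτ => ?_⟩
  · obtain ⟨τ, hτ, hmax⟩ := BetheLSM.exists_isMax_betheValue F
    exact ⟨τ, hτ, le_antisymm (le_iSup₂ (f := fun τ _ => BetheLSM.betheValue F τ) τ hτ)
      (iSup₂_le hmax)⟩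
  · have h := hm.mem_localPolytope hτ
    exact ⟨h, BetheLSM.betheValue_le hF h⟩
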